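/- Let $0<w<1/2$ and let $\ell\in(0,1/2)$ be irrational. A gambler whose fortune is $f\in[0,1]$ may stake any amount $s$ with $0\le s\le\min\{\ell,f,1-f\}$; independently of the past, the fortune becomes $f+s$ with probability $w$ and $f-s$ with probability $1-w$. The goal is to reach fortune $1$. Bold play is the strategy that always stakes $s(f)=\min\{\ell,f,1-f\}$, where $f$ is the current fortune. Let $Q(f)$ be the probability that bold play started from $f$ reaches $1$ after finitely many bets. Then bold play is not optimal: from some initial fortune in $[0,1]$, some strategy (in which the stake may depend on the outcomes of the past bets and on the current fortune) reaches $1$ with a strictly larger probability than bold play. Explicitly, there exist $f\in(0,1)$ and $\epsilon\in(0,s(f))$ such that $$wQ(f+s(f)-\epsilon)+(1-w)Q(f-s(f)+\epsilon)>Q(f).$$ -/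

import Mathlib

open MeasureTheory ProbabilityTheory

noncomputable section

namespace RedAndBlack

/-- The bold stake `s(f) = min {ℓ, f, 1 - f}` at the fortune `f`, under the stake limit `ℓ`. -/
def boldStake (ℓ f : ℝ) : ℝ := min ℓ (min f (1 - f))

/-- A (history dependent) betting strategy: the next stake, given the list of the outcomes of the
past bets in chronological order (`true` is a win) and the current fortune. -/
abbrev Strategy : Type := List Bool → ℝ → ℝ

/-- At every fortune in `[0, 1]` the stake is nonnegative, at most the limit `ℓ`, at most the
current fortune, and at most what is needed to reach the goal `1`. -/
def IsAdmissible (ℓ : ℝ) (σ : Strategy) : Prop :=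
  ∀ (h : List Bool) (x : ℝ), x ∈ Set.Icc (0 : ℝ) 1 →
    0 ≤ σ h x ∧ σ h x ≤ ℓ ∧ σ h x ≤ x ∧ σ h x ≤ 1 - x

/-- Bold play: always stake `min {ℓ, f, 1 - f}`. -/
def bold (ℓ : ℝ) : Strategy := fun _ x => boldStake ℓ x

/-- The fortune after `k` bets of a gambler who starts with fortune `f` and uses the strategy `σ`;
`ω k` tells whether the bet number `k` (counted from `0`) is won. -/
def fortune (σ : Strategy) (f : ℝ) (ω : ℕ → Bool) : ℕ → ℝ
  | 0 => f
  | k + 1 =>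
    let x := fortune σ f ω k
    let s := σ (List.ofFn fun i : Fin k => ω i) x
    if ω k = true then x + s else x - s

/-- The law of the outcomes of the bets: independent, each bet is won with probability `w`. -/
def betLaw (w : unitInterval) : Measure (ℕ → Bool) :=
  Measure.infinitePi fun _ : ℕ => bernoulliMeasure true false w

/-- The probability of reaching the fortune `1` after finitely many bets, from the initial
fortune `f`, under the strategy `σ`. -/
def successProb (w : unitInterval) (σ : Strategy) (f : ℝ) : ℝ :=
  (betLaw w).real {ω | ∃ k : ℕ, fortune σ f ω k = 1}

/-- `Q f`: the probability that bold play, started at `f`, reaches `1`. -/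
def Q (w : unitInterval) (ℓ f : ℝ) : ℝ := successProb w (bold ℓ) f

/-- An admissible strategy is optimal if, from every initial fortune in `[0, 1]`, it maximizes the
probability of reaching `1` among all admissible strategies. -/
def IsOptimal (w : unitInterval) (ℓ : ℝ) (σ : Strategy) : Prop :=
  IsAdmissible ℓ σ ∧
    ∀ f ∈ Set.Icc (0 : ℝ) 1, ∀ τ : Strategy, IsAdmissible ℓ τ →
      successProb w τ f ≤ successProb w σ f

/-- Bold play is admissible, so that non-optimality of it means that it can be improved upon. -/
theorem isAdmissible_bold {ℓ : ℝ} (hℓ : 0 ≤ ℓ) : IsAdmissible ℓ (bold ℓ) := by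
  intro h x hx
  have h1 : (0 : ℝ) ≤ 1 - x := sub_nonneg.2 hx.2
  exact ⟨le_min hℓ (le_min hx.1 h1), min_le_left _ _,
    (min_le_right _ _).trans (min_le_left _ _), (min_le_right _ _).trans (min_le_right _ _)⟩

end RedAndBlack

end

namespace RedAndBlack

/-! Write `F` for the value of bold play, and measure the increment of `F` over `[x - 2⁻ⁿ, x]` in
units of `gap F n`, the same increment at `1`. For large `n` the functional equation gives `gap F (n
+ 1) = (1 - w) * gap F n`. In these units one bold bet acts simply on slopes: the slope at `x ≤ ℓ`
is `w / (1 - w) < 1` times the slope at `2 * x`; in the middle zone it is the `w`-average of the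
slopes at `x ± ℓ`; near the top it equals the slope at `2 * x - 1`.

Hence points from which bold play can reach `1` along suitable paths inherit a positive slope
(`HasSlope`). Suppose no smaller stake helps. Then all slopes are bounded (`exists_increment_le`),
and at points from which bold play never reaches `1` the bound contracts repeatedly, so the slope
vanishes (`slopeLE_of_mem_nonposPart`). Irrationality of `ℓ` provides such points: the rational part
of `p + r * ℓ` becomes `2 * p`, `p` or `2 * p - 1`, so it never becomes positive once `p ≤ 0`.

Finally choose `f` with positive slope at `f - ℓ` and zero slope at `f + ℓ`. At `f - ε`, staking `ℓ
- ε` instead of `ℓ` gains an increment ending at `f - ℓ` and loses a negligible one just below `f +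
ℓ`: a contradiction (`not_noTimidGain`). -/

instance isProbabilityMeasure_betLaw (w : unitInterval) : IsProbabilityMeasure (betLaw w) := by
  unfold betLaw; infer_instance

/-! ### Conditioning on the first bet -/

/-- The sequence of outcomes whose first outcome is `b`, followed by `ω`. -/
def consOutcome (b : Bool) (ω : ℕ → Bool) : ℕ → Bool
  | 0 => b
  | k + 1 => ω k

theorem measurable_consOutcome (b : Bool) : Measurable (consOutcome b) := by
  refine measurable_pi_lambda _ fun k => ?_
  cases k with
  | zero => exact measurable_const
  | succ k => exact measurable_pi_apply k

theorem consOutcome_preimage_pi (b : Bool) (s : Finset ℕ) (t : ℕ → Set Bool) :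
    consOutcome b ⁻¹' (Set.pi s t) =
      {_ω | 0 ∈ s → b ∈ t 0} ∩
        Set.pi (s.preimage Nat.succ Nat.succ_injective.injOn) fun i => t (i + 1) := by
  ext ω
  simp only [Set.mem_preimage, Set.mem_pi, Set.mem_inter_iff, Set.mem_ofPred_eq,
    Finset.coe_preimage, Finset.mem_coe]
  constructor
  · intro h
    exact ⟨fun h0 => h 0 h0, fun i hi => h (i + 1) hi⟩
  · rintro ⟨h0, h1⟩ i hi
    cases i with
    | zero => exact h0 hi
    | succ i => exact h1 i hi

theorem prod_eq_zero_mul_preimage_succ {M : Type*} [CommMonoid M] (s : Finset ℕ) (f : ℕ → M) :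
    ∏ i ∈ s, f i =
      (if 0 ∈ s then f 0 else 1) *
        ∏ i ∈ s.preimage Nat.succ Nat.succ_injective.injOn, f (i + 1) := by
  classical
  have h := Finset.prod_preimage' Nat.succ s Nat.succ_injective.injOn f
  simp only [Nat.succ_eq_add_one] at h
  rw [h, ← Finset.prod_filter_mul_prod_filter_not s (fun i => i = 0), Finset.filter_eq']
  congr 1
  · split_ifs <;> simp
  · refine Finset.prod_congr (Finset.filter_congr fun i _ => ?_) fun _ _ => rfl
    cases i <;> simp

/-- By uniqueness of the product measure it suffices to compare finite boxes, where only the factor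
at coordinate `0` depends on the first outcome. -/
theorem betLaw_eq (w : unitInterval) :
    betLaw w = ENNReal.ofReal w • (betLaw w).map (consOutcome true) +
      ENNReal.ofReal (1 - w) • (betLaw w).map (consOutcome false) := by
  classical
  symm
  refine Measure.eq_infinitePi _ fun s t ht => ?_
  have hm : MeasurableSet (Set.pi (s : Set ℕ) t) :=
    MeasurableSet.pi s.countable_toSet fun i _ => ht i
  have key : ∀ b, (betLaw w).map (consOutcome b) (Set.pi s t) =
      (if 0 ∈ s → b ∈ t 0 then 1 else 0) *
        ∏ i ∈ s.preimage Nat.succ Nat.succ_injective.injOn,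
          bernoulliMeasure true false w (t (i + 1)) := by
    intro b
    rw [Measure.map_apply (measurable_consOutcome b) hm, consOutcome_preimage_pi]
    by_cases h : 0 ∈ s → b ∈ t 0
    · rw [if_pos h, one_mul, betLaw,
        ← Measure.infinitePi_pi (fun _ => bernoulliMeasure true false w)]
      · congr 1
        ext ω
        exact and_iff_right h
      · intro i hi
        exact ht _
    · rw [if_neg h, zero_mul]
      convert measure_empty (μ := betLaw w)
      ext ω
      simp only [h, Set.mem_inter_iff, Set.mem_ofPred_eq, false_and, Set.mem_empty_iff_false]
  simp only [Measure.add_apply, Measure.smul_apply, smul_eq_mul, key]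
  rw [prod_eq_zero_mul_preimage_succ s fun i => bernoulliMeasure true false w (t i),
    ← mul_assoc, ← mul_assoc, ← add_mul]
  congr 1
  by_cases h0 : 0 ∈ s
  · simp only [h0, if_true, forall_const, bernoulliMeasure_def]
    simp only [Measure.add_apply, Measure.smul_apply, Measure.dirac_apply, Set.indicator_apply,
      Pi.one_apply]
    have h1 : ENNReal.ofReal w = (unitInterval.toNNReal w : ENNReal) := by
      rw [ENNReal.ofReal, Real.toNNReal_of_nonneg w.2.1]; rfl
    have h2 : ENNReal.ofReal (1 - w) = (unitInterval.toNNReal (unitInterval.symm w) : ENNReal) := by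
      rw [ENNReal.ofReal, Real.toNNReal_of_nonneg (sub_nonneg.2 w.2.2)]; rfl
    rw [h1, h2]
    rfl
  · simp only [h0, false_imp_iff, if_true, if_false, mul_one]
    rw [← ENNReal.ofReal_add w.2.1 (sub_nonneg.2 w.2.2)]
    simp

theorem betLaw_real (w : unitInterval) {E : Set (ℕ → Bool)} (hE : MeasurableSet E) :
    (betLaw w).real E = w * (betLaw w).real (consOutcome true ⁻¹' E) +
      (1 - w) * (betLaw w).real (consOutcome false ⁻¹' E) := by
  have h := congrArg (fun μ : Measure (ℕ → Bool) => (μ E).toReal) (betLaw_eq w)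
  simp only [Measure.add_apply, Measure.smul_apply, smul_eq_mul,
    Measure.map_apply (measurable_consOutcome _) hE] at h
  rw [ENNReal.toReal_add (by finiteness) (by finiteness), ENNReal.toReal_mul, ENNReal.toReal_mul,
    ENNReal.toReal_ofReal w.2.1, ENNReal.toReal_ofReal (sub_nonneg.2 w.2.2)] at h
  exact h

/-- The strategy that remains after the first bet has had the outcome `b`. -/
def Strategy.tail (σ : Strategy) (b : Bool) : Strategy := fun h x => σ (b :: h) x

/-- The fortune after the first bet, whose outcome is `b`. -/
def firstFortune (σ : Strategy) (f : ℝ) (b : Bool) : ℝ :=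
  if b = true then f + σ [] f else f - σ [] f

theorem fortune_consOutcome (σ : Strategy) (f : ℝ) (b : Bool) (ω : ℕ → Bool) (k : ℕ) :
    fortune σ f (consOutcome b ω) (k + 1) = fortune (σ.tail b) (firstFortune σ f b) ω k := by
  induction k with
  | zero => rfl
  | succ k ih =>
    rw [fortune, ih, fortune, List.ofFn_succ]
    rfl

theorem fortune_congr (σ : Strategy) (f : ℝ) {ω ω' : ℕ → Bool} {k : ℕ}
    (h : ∀ i < k, ω i = ω' i) : fortune σ f ω k = fortune σ f ω' k := by
  induction k with
  | zero => rfl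
  | succ k ih =>
    have e : (List.ofFn fun i : Fin k => ω i) = List.ofFn fun i : Fin k => ω' i := by
      congr 1
      funext i
      exact h i (by omega)
    rw [fortune, fortune, ih fun i hi => h i (by omega), h k (by omega), e]

/-- The event depends on the first `k` outcomes only, and these range over a finite space. -/
theorem measurableSet_fortune_eq (σ : Strategy) (f c : ℝ) (k : ℕ) :
    MeasurableSet {ω | fortune σ f ω k = c} := by
  have h : {ω | fortune σ f ω k = c} =
      (fun (ω : ℕ → Bool) (i : Fin k) => ω i) ⁻¹'
        ((fun (ω : ℕ → Bool) (i : Fin k) => ω i) '' {ω | fortune σ f ω k = c}) := by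
    refine (Set.subset_preimage_image _ _).antisymm ?_
    rintro ω ⟨ω', h', e⟩
    rw [Set.mem_ofPred_eq, ← fortune_congr σ f (ω := ω'), h']
    intro i hi
    exact congrFun e ⟨i, hi⟩
  rw [h]
  exact (Set.toFinite _).measurableSet.preimage
    (measurable_pi_lambda _ fun i => measurable_pi_apply _)

theorem measurableSet_success (σ : Strategy) (f : ℝ) :
    MeasurableSet {ω | ∃ k : ℕ, fortune σ f ω k = 1} := by
  rw [Set.ofPred_exists]
  exact MeasurableSet.iUnion fun k => measurableSet_fortune_eq σ f 1 k

/-- The hypothesis `hf` keeps a success at time `0` from being lost by the first bet. -/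
theorem successProb_eq (w : unitInterval) (σ : Strategy) {f : ℝ} (hf : f = 1 → σ [] f = 0) :
    successProb w σ f = w * successProb w (σ.tail true) (f + σ [] f) +
      (1 - w) * successProb w (σ.tail false) (f - σ [] f) := by
  have key : ∀ b, consOutcome b ⁻¹' {ω | ∃ k : ℕ, fortune σ f ω k = 1} =
      {ω | ∃ k : ℕ, fortune (σ.tail b) (firstFortune σ f b) ω k = 1} := by
    intro b
    ext ω
    constructor
    · rintro ⟨k, hk⟩
      cases k with
      | zero =>
        refine ⟨0, ?_⟩
        change f = 1 at hk
        have h0 := hf hk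
        change firstFortune σ f b = 1
        rw [firstFortune, h0, add_zero, sub_zero, ite_self, hk]
      | succ k => exact ⟨k, by rw [← fortune_consOutcome]; exact hk⟩
    · rintro ⟨k, hk⟩
      exact ⟨k + 1, by rw [fortune_consOutcome]; exact hk⟩
  rw [successProb, betLaw_real w (measurableSet_success σ f), key, key]
  rfl

theorem measureReal_fortune_succ (w : unitInterval) (σ : Strategy) (f : ℝ) (k : ℕ) :
    (betLaw w).real {ω | fortune σ f ω (k + 1) = 1} =
      w * (betLaw w).real {ω | fortune (σ.tail true) (f + σ [] f) ω k = 1} +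
      (1 - w) * (betLaw w).real {ω | fortune (σ.tail false) (f - σ [] f) ω k = 1} := by
  have key : ∀ b, consOutcome b ⁻¹' {ω | fortune σ f ω (k + 1) = 1} =
      {ω | fortune (σ.tail b) (firstFortune σ f b) ω k = 1} := by
    intro b
    ext ω
    simp [fortune_consOutcome]
  rw [betLaw_real w (measurableSet_fortune_eq σ f 1 _), key, key]
  rfl

/-! ### The value of bold play -/

section Bold

variable {w : unitInterval} {ℓ : ℝ}

theorem boldStake_one (hℓ : 0 ≤ ℓ) : boldStake ℓ 1 = 0 := by
  simp [boldStake, hℓ]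

theorem fortune_bold_succ_eq_one (hℓ : 0 ≤ ℓ) {f : ℝ} {ω : ℕ → Bool} {k : ℕ}
    (h : fortune (bold ℓ) f ω k = 1) : fortune (bold ℓ) f ω (k + 1) = 1 := by
  rw [fortune, h]
  simp [bold, boldStake_one hℓ]

/-- The fortune `1` is absorbing, so the events increase with `k`. Properties of `Q` thus follow
from inductions on the number of bets. -/
theorem tendsto_measureReal_fortune_bold (hℓ : 0 ≤ ℓ) (f : ℝ) :
    Filter.Tendsto (fun k => (betLaw w).real {ω | fortune (bold ℓ) f ω k = 1}) Filter.atTop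
      (nhds (Q w ℓ f)) := by
  have hmono : Monotone fun k => {ω | fortune (bold ℓ) f ω k = 1} :=
    monotone_nat_of_le_succ fun k ω h => fortune_bold_succ_eq_one hℓ h
  have h := tendsto_measure_iUnion_atTop (μ := betLaw w) hmono
  rw [← Set.ofPred_exists] at h
  exact (ENNReal.tendsto_toReal (measure_ne_top _ _)).comp h

theorem Q_eq (hℓ : 0 ≤ ℓ) (f : ℝ) :
    Q w ℓ f = w * Q w ℓ (f + boldStake ℓ f) + (1 - w) * Q w ℓ (f - boldStake ℓ f) :=
  successProb_eq w (bold ℓ) (by rintro rfl; exact boldStake_one hℓ)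

theorem Q_zero (hℓ : 0 ≤ ℓ) : Q w ℓ 0 = 0 := by
  have h : ∀ (ω : ℕ → Bool) (k : ℕ), fortune (bold ℓ) 0 ω k = 0 := by
    intro ω k
    induction k with
    | zero => rfl
    | succ k ih =>
      rw [fortune, ih]
      simp [bold, boldStake, hℓ]
  simp [Q, successProb, h]

theorem Q_one : Q w ℓ 1 = 1 := by
  have h : {ω | ∃ k : ℕ, fortune (bold ℓ) 1 ω k = 1} = Set.univ :=
    Set.eq_univ_of_forall fun ω => ⟨0, rfl⟩
  rw [Q, successProb, h, probReal_univ]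

theorem boldStake_le_add {x y : ℝ} (h : x ≤ y) : boldStake ℓ y ≤ boldStake ℓ x + (y - x) := by
  simp only [boldStake, min_def]
  split_ifs <;> linarith

theorem boldStake_le_add' {x y : ℝ} (h : x ≤ y) : boldStake ℓ x ≤ boldStake ℓ y + (y - x) := by
  simp only [boldStake, min_def]
  split_ifs <;> linarith

/-- The bold stake is 1-Lipschitz, so both `x + s(x)` and `x - s(x)` are monotone in `x`. -/
theorem measureReal_fortune_bold_mono (hℓ : 0 ≤ ℓ) (k : ℕ) :
    MonotoneOn (fun f => (betLaw w).real {ω | fortune (bold ℓ) f ω k = 1}) (Set.Icc 0 1) := by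
  induction k with
  | zero =>
    intro x hx y hy hxy
    rcases eq_or_lt_of_le hx.2 with h | h
    · obtain rfl : x = y := le_antisymm hxy (h ▸ hy.2)
      exact le_rfl
    · simp only [fortune, h.ne, Set.ofPred_false, measureReal_empty]
      exact measureReal_nonneg
  | succ k ih =>
    intro x hx y hy hxy
    have bx := isAdmissible_bold hℓ [] x hx
    have hb := isAdmissible_bold hℓ [] y hy
    simp only [bold] at bx hb
    have h1 := boldStake_le_add (ℓ := ℓ) hxy
    have h2 := boldStake_le_add' (ℓ := ℓ) hxy
    simp only [measureReal_fortune_succ]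
    refine add_le_add (mul_le_mul_of_nonneg_left ?_ w.2.1)
      (mul_le_mul_of_nonneg_left ?_ (sub_nonneg.2 w.2.2))
    · refine ih ⟨?_, ?_⟩ ⟨?_, ?_⟩ ?_ <;> simp only [bold] <;> linarith [hx.1, hy.1]
    · refine ih ⟨?_, ?_⟩ ⟨?_, ?_⟩ ?_ <;> simp only [bold] <;> linarith [hx.2, hy.2]

/-- The fortune is a supermartingale, since the game is not favourable. -/
theorem measureReal_fortune_bold_le (hℓ : 0 ≤ ℓ) (hw : (w : ℝ) ≤ 1 / 2) (k : ℕ) :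
    ∀ f ∈ Set.Icc (0 : ℝ) 1, (betLaw w).real {ω | fortune (bold ℓ) f ω k = 1} ≤ f := by
  induction k with
  | zero =>
    intro f hf
    rcases eq_or_lt_of_le hf.2 with h | h
    · rw [h]; exact measureReal_le_one
    · simpa only [fortune, h.ne, Set.ofPred_false, measureReal_empty] using hf.1
  | succ k ih =>
    intro f hf
    obtain ⟨h0, -, h1, h2⟩ := isAdmissible_bold hℓ [] f hf
    rw [measureReal_fortune_succ]
    have i1 := mul_le_mul_of_nonneg_left (ih (f + bold ℓ [] f) ⟨by linarith [hf.1], by linarith⟩)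
      w.2.1
    have i2 := mul_le_mul_of_nonneg_left (ih (f - bold ℓ [] f) ⟨by linarith, by linarith [hf.2]⟩)
      (sub_nonneg.2 w.2.2)
    refine (add_le_add i1 i2).trans ?_
    nlinarith

theorem Q_monotoneOn (hℓ : 0 ≤ ℓ) : MonotoneOn (Q w ℓ) (Set.Icc 0 1) := fun _ hx _ hy hxy =>
  le_of_tendsto_of_tendsto' (tendsto_measureReal_fortune_bold hℓ _)
    (tendsto_measureReal_fortune_bold hℓ _) fun k => measureReal_fortune_bold_mono hℓ k hx hy hxy

theorem Q_le_self (hℓ : 0 ≤ ℓ) (hw : (w : ℝ) ≤ 1 / 2) {f : ℝ} (hf : f ∈ Set.Icc (0 : ℝ) 1) :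
    Q w ℓ f ≤ f :=
  le_of_tendsto' (tendsto_measureReal_fortune_bold hℓ _) fun k =>
    measureReal_fortune_bold_le hℓ hw k f hf

/-- The strategy that stakes `ε` less than bold play on the first bet at the fortune `f`, and plays
boldly from then on. -/
noncomputable def timidFirst (ℓ f ε : ℝ) : Strategy := fun h x =>
  if h = [] ∧ x = f then boldStake ℓ f - ε else boldStake ℓ x

theorem not_isOptimal_bold (hℓ : 0 ≤ ℓ) {f ε : ℝ} (hf : f ∈ Set.Ioo (0 : ℝ) 1)
    (hε : ε ∈ Set.Ioo 0 (boldStake ℓ f))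
    (h : Q w ℓ f < w * Q w ℓ (f + boldStake ℓ f - ε) + (1 - w) * Q w ℓ (f - boldStake ℓ f + ε)) :
    ¬ IsOptimal w ℓ (bold ℓ) := by
  rintro ⟨-, hopt⟩
  have hadm : IsAdmissible ℓ (timidFirst ℓ f ε) := by
    intro l x hx
    obtain ⟨h0, h1, h2, h3⟩ := isAdmissible_bold hℓ l x hx
    simp only [bold] at h0 h1 h2 h3
    unfold timidFirst
    split_ifs with hc
    · obtain ⟨-, rfl⟩ := hc
      refine ⟨?_, ?_, ?_, ?_⟩ <;> linarith [hε.1, hε.2]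
    · exact ⟨h0, h1, h2, h3⟩
  have hle := hopt f ⟨hf.1.le, hf.2.le⟩ _ hadm
  have htail : ∀ b, (timidFirst ℓ f ε).tail b = bold ℓ := by
    intro b
    funext l x
    simp [Strategy.tail, timidFirst, bold]
  have hfirst : timidFirst ℓ f ε [] f = boldStake ℓ f - ε := by simp [timidFirst]
  rw [successProb_eq w _ (fun hf1 => absurd hf1 hf.2.ne), htail, htail, hfirst, ← add_sub_assoc,
    ← sub_add] at hle
  exact absurd h (not_lt.2 hle)

end Bold

/-! ### Functional equation and dyadic increments -/

/-- The analytic properties of the success probability of bold play that are used below. -/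
structure IsBoldValue (w ℓ : ℝ) (F : ℝ → ℝ) : Prop where
  w_pos : 0 < w
  w_lt : w < 1 / 2
  ℓ_pos : 0 < ℓ
  ℓ_lt : ℓ < 1 / 2
  map_zero : F 0 = 0
  map_one : F 1 = 1
  mono : MonotoneOn F (Set.Icc 0 1)
  le_self : ∀ x ∈ Set.Icc (0 : ℝ) 1, F x ≤ x
  eq : ∀ x, F x = w * F (x + boldStake ℓ x) + (1 - w) * F (x - boldStake ℓ x)

/-- No stake strictly between `0` and the bold one, followed by bold play, beats bold play. -/
def NoTimidGain (w ℓ : ℝ) (F : ℝ → ℝ) : Prop :=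
  ∀ x ∈ Set.Ioo (0 : ℝ) 1, ∀ s ∈ Set.Ioo 0 (boldStake ℓ x),
    w * F (x + s) + (1 - w) * F (x - s) ≤ F x

/-- The increment of `F` over the interval of length `2⁻ⁿ` with right end `1`. -/
noncomputable def gap (F : ℝ → ℝ) (n : ℕ) : ℝ := F 1 - F (1 - (1 / 2) ^ n)

/-- Eventually, the increment of `F` over the interval of length `2⁻ⁿ` with right end `x` is at most
`M * gap F n`. -/
def SlopeLE (F : ℝ → ℝ) (x M : ℝ) : Prop :=
  ∀ᶠ n : ℕ in Filter.atTop, F x - F (x - (1 / 2) ^ n) ≤ M * gap F n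

/-- Eventually, the increment of `F` over the interval of length `2⁻ⁿ` with right end `x` is at
least a positive multiple of `gap F n`. -/
def HasSlope (F : ℝ → ℝ) (x : ℝ) : Prop :=
  ∃ c > 0, ∀ᶠ n : ℕ in Filter.atTop, c * gap F n ≤ F x - F (x - (1 / 2) ^ n)

theorem eventually_half_pow_le {a : ℝ} (ha : 0 < a) :
    ∀ᶠ n : ℕ in Filter.atTop, (1 / 2 : ℝ) ^ n ≤ a :=
  (tendsto_pow_atTop_nhds_zero_of_lt_one (by norm_num) (by norm_num)).eventually_le_const ha

theorem hasSlope_one (F : ℝ → ℝ) : HasSlope F 1 :=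
  ⟨1, one_pos, Filter.Eventually.of_forall fun n => by rw [one_mul]; exact le_rfl⟩

namespace IsBoldValue

variable {w ℓ : ℝ} {F : ℝ → ℝ}

theorem eq_bottom (hF : IsBoldValue w ℓ F) {x : ℝ} (hx : x ≤ ℓ) : F x = w * F (2 * x) := by
  have h := hF.eq x
  have hℓ := hF.ℓ_lt
  rw [boldStake, min_eq_left (by linarith : x ≤ 1 - x), min_eq_right hx, sub_self, hF.map_zero] at h
  rw [h, two_mul]
  ring

theorem eq_middle (hF : IsBoldValue w ℓ F) {x : ℝ} (h1 : ℓ ≤ x) (h2 : x ≤ 1 - ℓ) :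
    F x = w * F (x + ℓ) + (1 - w) * F (x - ℓ) := by
  have h := hF.eq x
  rwa [boldStake, min_eq_left (le_min h1 (by linarith))] at h

theorem eq_top (hF : IsBoldValue w ℓ F) {x : ℝ} (hx : 1 - ℓ ≤ x) :
    F x = w + (1 - w) * F (2 * x - 1) := by
  have h := hF.eq x
  have hℓ := hF.ℓ_lt
  rw [boldStake, min_eq_right (by linarith : 1 - x ≤ x), min_eq_right (by linarith),
    add_sub_cancel, hF.map_one, mul_one] at h
  rw [h]
  congr 3
  ring

theorem half_pow_le_gap (hF : IsBoldValue w ℓ F) (n : ℕ) : (1 / 2) ^ n ≤ gap F n := by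
  have h1 : (1 / 2 : ℝ) ^ n ≤ 1 := pow_le_one₀ (by norm_num) (by norm_num)
  have h0 : 0 < (1 / 2 : ℝ) ^ n := by positivity
  have := hF.le_self (1 - (1 / 2) ^ n) ⟨by linarith, by linarith⟩
  rw [gap, hF.map_one]
  linarith

theorem gap_pos (hF : IsBoldValue w ℓ F) (n : ℕ) : 0 < gap F n :=
  (by positivity : (0 : ℝ) < (1 / 2) ^ n).trans_le (hF.half_pow_le_gap n)

theorem gap_succ (hF : IsBoldValue w ℓ F) {n : ℕ} (hn : (1 / 2) ^ (n + 1) ≤ ℓ) :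
    gap F (n + 1) = (1 - w) * gap F n := by
  rw [gap, gap, hF.eq_top (x := 1 - (1 / 2) ^ (n + 1)) (by linarith), hF.map_one,
    show (2 : ℝ) * (1 - (1 / 2) ^ (n + 1)) - 1 = 1 - (1 / 2) ^ n by ring]
  ring

/-! ### Upper bound for all increments -/

/-- If bold play cannot be improved, the increments of `F` over intervals of length `δ` are
controlled by those over intervals of length `2 * δ`. -/
theorem increment_le_of_double (hF : IsBoldValue w ℓ F) (hH : NoTimidGain w ℓ F) {δ B T : ℝ}
    (hδ0 : 0 < δ) (hδ2 : 2 * δ ≤ 1 - 2 * ℓ) (hT0 : F 1 - F (1 - δ) ≤ T)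
    (hB : ∀ z, 0 ≤ z → z + 2 * δ ≤ 1 → F (z + 2 * δ) - F z ≤ B)
    (hBT : w * B + (1 - w) * (F 1 - F (1 - δ)) ≤ T) :
    ∀ z, 0 ≤ z → z + δ ≤ 1 → F (z + δ) - F z ≤ T := by
  have w0 := hF.w_pos
  have w1 := hF.w_lt
  have l0 := hF.ℓ_pos
  have l1 := hF.ℓ_lt
  have hTnn : 0 ≤ T := by
    have := hF.le_self (1 - δ) ⟨by linarith, by linarith⟩
    rw [hF.map_one] at hT0
    linarith
  have hdδ : δ ≤ F 1 - F (1 - δ) := by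
    have := hF.le_self (1 - δ) ⟨by linarith, by linarith⟩
    rw [hF.map_one]
    linarith
  -- When `z + δ` crosses `ℓ`, the winning branch is compared with `2 * z + 2 * δ` by monotonicity,
  -- and the losing branch lands at a fortune at most `δ`, where `F ≤ id` suffices.
  have bottom : ∀ z, 0 ≤ z → z ≤ ℓ → F (z + δ) - F z ≤ T := by
    intro z z0 zl
    have hwB := mul_le_mul_of_nonneg_left (hB (2 * z) (by linarith) (by linarith)) w0.le
    rw [hF.eq_bottom zl]
    rcases le_total (z + δ) ℓ with h | h
    · rw [hF.eq_bottom h, mul_add]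
      have := mul_nonneg (by linarith : 0 ≤ 1 - w) (hδ0.le.trans hdδ)
      linarith
    · rw [hF.eq_middle h (by linarith)]
      have m := mul_le_mul_of_nonneg_left (hF.mono (a := z + δ + ℓ) (b := 2 * z + 2 * δ)
        ⟨by linarith, by linarith⟩ ⟨by linarith, by linarith⟩ (by linarith)) w0.le
      have s := mul_le_mul_of_nonneg_left ((hF.le_self (z + δ - ℓ)
        ⟨by linarith, by linarith⟩).trans (by linarith : _ ≤ F 1 - F (1 - δ)))
        (by linarith : 0 ≤ 1 - w)
      linarith
  -- `NoTimidGain` enters here: the stake `1 - z - δ` at `z`, matching the bold stake at `z + δ`,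
  -- splits the increment into one of length `δ` ending at `1` and another of length `δ`.
  have top : ∀ E, 0 ≤ E → (∀ z, 0 ≤ z → z + δ ≤ 1 → F (z + δ) - F z ≤ T + E) →
      ∀ z, ℓ < z → 1 - ℓ < z + δ → z + δ ≤ 1 → F (z + δ) - F z ≤ T + (1 - w) * E := by
    intro E hE hS z zl h1 h2
    rcases eq_or_lt_of_le h2 with h | h
    · rw [h, show z = 1 - δ by linarith]
      have := mul_nonneg (by linarith : 0 ≤ 1 - w) hE
      linarith
    · have hst := hH z ⟨by linarith, by linarith⟩ (1 - z - δ)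
        ⟨by linarith, lt_min (by linarith) (lt_min (by linarith) (by linarith))⟩
      have hd := mul_le_mul_of_nonneg_left (hS (2 * z + δ - 1) (by linarith) (by linarith))
        (by linarith : 0 ≤ 1 - w)
      have hg := mul_le_mul_of_nonneg_left hT0 w0.le
      rw [hF.map_one] at hg
      rw [hF.eq_top h1.le]
      rw [show z + (1 - z - δ) = 1 - δ by ring, show z - (1 - z - δ) = 2 * z + δ - 1 by ring] at hst
      rw [show 2 * z + δ - 1 + δ = 2 * (z + δ) - 1 by ring] at hd
      linarith
  obtain ⟨N, hN⟩ := exists_nat_ge (1 / ℓ)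
  rw [div_le_iff₀ l0] at hN
  -- `E` is the excess of an a priori bound over `T`. At most `j` losses bring `z` into the bottom
  -- zone, where there is no excess, so at least the fraction `w ^ j` of `E` is removed; `1 - w ≥ w`
  -- carries the induction.
  have step : ∀ E, 0 ≤ E → (∀ z, 0 ≤ z → z + δ ≤ 1 → F (z + δ) - F z ≤ T + E) →
      ∀ j : ℕ, ∀ z, 0 ≤ z → z + δ ≤ 1 → z ≤ j * ℓ → F (z + δ) - F z ≤ T + (1 - w ^ j) * E := by
    intro E hE hS j
    induction j with
    | zero =>
      intro z z0 _ zj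
      have := bottom z z0 (by simp at zj; linarith)
      simpa using this
    | succ j ih =>
      intro z z0 z1 zj
      push_cast at zj
      have wj : w ^ j ≤ 1 := pow_le_one₀ w0.le (by linarith)
      have wj0 : 0 ≤ w ^ j := by positivity
      rw [pow_succ]
      rcases le_or_gt z ℓ with h | h
      · have := bottom z z0 h
        have : 0 ≤ (1 - w ^ j * w) * E := mul_nonneg (by nlinarith) hE
        linarith
      rcases le_or_gt (z + δ) (1 - ℓ) with h' | h'
      · have h1 := mul_le_mul_of_nonneg_left (hS (z + ℓ) (by linarith) (by linarith)) w0.le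
        have h2 := mul_le_mul_of_nonneg_left (ih (z - ℓ) (by linarith) (by linarith) (by linarith))
          (by linarith : 0 ≤ 1 - w)
        rw [hF.eq_middle h.le (by linarith), hF.eq_middle (x := z + δ) (by linarith) h',
          show z + δ + ℓ = z + ℓ + δ by ring, show z + δ - ℓ = z - ℓ + δ by ring]
        have : 0 ≤ (1 - 2 * w) * (w ^ j * E) := by
          have := mul_nonneg wj0 hE
          exact mul_nonneg (by linarith) this
        linarith
      · have := top E hE hS z h h' z1
        have : 0 ≤ w * ((1 - w ^ j) * E) := by
          exact mul_nonneg w0.le (mul_nonneg (by linarith) hE)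
        linarith
  have wN : w ^ N ≤ 1 := pow_le_one₀ w0.le (by linarith)
  have wN0 : 0 < w ^ N := by positivity
  have iter : ∀ i : ℕ, ∀ z, 0 ≤ z → z + δ ≤ 1 → F (z + δ) - F z ≤ T + (1 - w ^ N) ^ i := by
    intro i
    induction i with
    | zero =>
      intro z z0 z1
      have h1 := hF.le_self (z + δ) ⟨by linarith, z1⟩
      have h2 := hF.mono ⟨le_rfl, zero_le_one⟩ ⟨z0, by linarith⟩ z0
      rw [hF.map_zero] at h2
      rw [pow_zero]
      linarith
    | succ i ih =>
      intro z z0 z1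
      have := step _ (pow_nonneg (by linarith) i) ih N z z0 z1 (by linarith)
      rwa [pow_succ']
  intro z z0 z1
  have lim : Filter.Tendsto (fun i : ℕ => T + (1 - w ^ N) ^ i) Filter.atTop (nhds (T + 0)) :=
    (tendsto_pow_atTop_nhds_zero_of_lt_one (by linarith) (by linarith)).const_add T
  rw [add_zero] at lim
  exact ge_of_tendsto' lim fun i => iter i z z0 z1

/-- If bold play cannot be improved, then up to a constant factor no increment of `F` over an
interval of length `2⁻ⁿ` exceeds `gap F n`. -/
theorem exists_increment_le (hF : IsBoldValue w ℓ F) (hH : NoTimidGain w ℓ F) :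
    ∃ C > 0, ∀ᶠ n : ℕ in Filter.atTop, ∀ z, 0 ≤ z → z + (1 / 2) ^ n ≤ 1 →
      F (z + (1 / 2) ^ n) - F z ≤ C * gap F n := by
  have w0 := hF.w_pos
  have w1 := hF.w_lt
  have l0 := hF.ℓ_pos
  have l1 := hF.ℓ_lt
  obtain ⟨n₀, hn₀⟩ := Filter.eventually_atTop.1
    (eventually_half_pow_le (a := min ℓ ((1 - 2 * ℓ) / 2)) (lt_min l0 (by linarith)))
  have g0 := hF.gap_pos n₀
  have hq : 0 < 1 - w / (1 - w) := by
    rw [sub_pos, div_lt_one (by linarith)]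
    linarith
  -- The three summands serve, in order, `gap ≤ T`, the base case, and the recursion `w / (1 - w) *
  -- C + (1 - w) ≤ C`.
  obtain ⟨C, hC⟩ : ∃ C : ℝ, C = 1 + 1 / gap F n₀ + (1 - w) / (1 - w / (1 - w)) := ⟨_, rfl⟩
  have p1 : 0 < 1 / gap F n₀ := by positivity
  have p2 : 0 < (1 - w) / (1 - w / (1 - w)) := div_pos (by linarith) hq
  refine ⟨C, by linarith, Filter.eventually_atTop.2 ⟨n₀, fun n hn => ?_⟩⟩
  induction n, hn using Nat.le_induction with
  | base =>
    intro z z0 z1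
    have hp : 0 < (1 / 2 : ℝ) ^ n₀ := by positivity
    have h1 := hF.le_self (z + (1 / 2) ^ n₀) ⟨by linarith, z1⟩
    have h2 := hF.mono ⟨le_rfl, zero_le_one⟩ ⟨z0, by linarith⟩ z0
    rw [hF.map_zero] at h2
    have : 1 ≤ C * gap F n₀ := by
      rw [← div_le_iff₀ g0]
      linarith
    linarith
  | succ n hn ih =>
    have hs := hn₀ (n + 1) (by omega)
    have hsl := hs.trans (min_le_left _ _)
    have hsr := hs.trans (min_le_right _ _)
    have gn := hF.gap_pos n
    have e := hF.gap_succ hsl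
    have g1 := hF.gap_pos (n + 1)
    have two : 2 * (1 / 2 : ℝ) ^ (n + 1) = (1 / 2) ^ n := by ring
    refine hF.increment_le_of_double hH (B := C * gap F n) (by positivity) (by linarith) ?_ ?_ ?_
    · change gap F (n + 1) ≤ _
      exact le_mul_of_one_le_left g1.le (by linarith)
    · rw [two]
      exact ih
    · change w * (C * gap F n) + (1 - w) * gap F (n + 1) ≤ _
      have key : (1 - w) ≤ C * (1 - w / (1 - w)) := by
        rw [← div_le_iff₀ hq]
        linarith
      have hgn : gap F n = gap F (n + 1) / (1 - w) := by
        rw [e, mul_div_cancel_left₀ _ (by linarith)]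
      rw [hgn]
      have := mul_le_mul_of_nonneg_right key g1.le
      calc w * (C * (gap F (n + 1) / (1 - w))) + (1 - w) * gap F (n + 1)
          ≤ w * (C * (gap F (n + 1) / (1 - w))) + C * (1 - w / (1 - w)) * gap F (n + 1) := by
            linarith
        _ = C * gap F (n + 1) := by ring

/-! ### Transport of slopes by one bold bet -/

theorem eventually_gap_eq (hF : IsBoldValue w ℓ F) :
    ∀ᶠ n : ℕ in Filter.atTop, gap F n = gap F (n + 1) / (1 - w) := by
  have w1 := hF.w_lt
  filter_upwards [eventually_half_pow_le hF.ℓ_pos] with n hn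
  have h : (1 / 2 : ℝ) ^ (n + 1) ≤ (1 / 2) ^ n :=
    pow_le_pow_of_le_one (by norm_num) (by norm_num) n.le_succ
  rw [hF.gap_succ (h.trans hn), mul_div_cancel_left₀ _ (by linarith)]

theorem increment_bottom (hF : IsBoldValue w ℓ F) {x : ℝ} (hx : x ≤ ℓ) (n : ℕ) :
    F x - F (x - (1 / 2) ^ (n + 1)) = w * (F (2 * x) - F (2 * x - (1 / 2) ^ n)) := by
  have hp : 0 < (1 / 2 : ℝ) ^ (n + 1) := by positivity
  rw [hF.eq_bottom hx, hF.eq_bottom (x := x - (1 / 2) ^ (n + 1)) (by linarith),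
    show 2 * (x - (1 / 2) ^ (n + 1)) = 2 * x - (1 / 2) ^ n by ring]
  ring

theorem eventually_increment_middle (hF : IsBoldValue w ℓ F) {x : ℝ} (h1 : ℓ < x) (h2 : x ≤ 1 - ℓ) :
    ∀ᶠ n : ℕ in Filter.atTop, F x - F (x - (1 / 2) ^ n) =
      w * (F (x + ℓ) - F (x + ℓ - (1 / 2) ^ n)) +
        (1 - w) * (F (x - ℓ) - F (x - ℓ - (1 / 2) ^ n)) := by
  filter_upwards [eventually_half_pow_le (sub_pos.2 h1)] with n hn
  have hp : 0 < (1 / 2 : ℝ) ^ n := by positivity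
  rw [hF.eq_middle h1.le h2, hF.eq_middle (x := x - (1 / 2) ^ n) (by linarith) (by linarith),
    show x - (1 / 2) ^ n + ℓ = x + ℓ - (1 / 2) ^ n by ring,
    show x - (1 / 2) ^ n - ℓ = x - ℓ - (1 / 2) ^ n by ring]
  ring

theorem eventually_increment_top (hF : IsBoldValue w ℓ F) {x : ℝ} (h1 : 1 - ℓ < x) :
    ∀ᶠ n : ℕ in Filter.atTop, F x - F (x - (1 / 2) ^ (n + 1)) =
      (1 - w) * (F (2 * x - 1) - F (2 * x - 1 - (1 / 2) ^ n)) := by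
  filter_upwards [eventually_half_pow_le (sub_pos.2 h1)] with n hn
  have h : (1 / 2 : ℝ) ^ (n + 1) ≤ (1 / 2) ^ n :=
    pow_le_pow_of_le_one (by norm_num) (by norm_num) n.le_succ
  rw [hF.eq_top h1.le, hF.eq_top (x := x - (1 / 2) ^ (n + 1)) (by linarith),
    show 2 * (x - (1 / 2) ^ (n + 1)) - 1 = 2 * x - 1 - (1 / 2) ^ n by ring]
  ring

theorem slopeLE_mono (hF : IsBoldValue w ℓ F) {x M M' : ℝ} (h : SlopeLE F x M) (hM : M ≤ M') :
    SlopeLE F x M' :=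
  h.mono fun n hn => hn.trans (mul_le_mul_of_nonneg_right hM (hF.gap_pos n).le)

theorem slopeLE_bottom (hF : IsBoldValue w ℓ F) {x M : ℝ} (hx : x ≤ ℓ) (h : SlopeLE F (2 * x) M) :
    SlopeLE F x (w / (1 - w) * M) := by
  rw [SlopeLE, ← Filter.map_add_atTop_eq_nat 1, Filter.eventually_map]
  filter_upwards [h, hF.eventually_gap_eq] with n hn e
  rw [hF.increment_bottom hx]
  refine (mul_le_mul_of_nonneg_left hn hF.w_pos.le).trans_eq ?_
  rw [e]
  ring

theorem slopeLE_middle (hF : IsBoldValue w ℓ F) {x M M' : ℝ} (h1 : ℓ < x) (h2 : x ≤ 1 - ℓ)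
    (h : SlopeLE F (x + ℓ) M) (h' : SlopeLE F (x - ℓ) M') :
    SlopeLE F x (w * M + (1 - w) * M') := by
  have w1 := hF.w_lt
  filter_upwards [h, h', hF.eventually_increment_middle h1 h2] with n hn hn' e
  rw [e]
  have i1 := mul_le_mul_of_nonneg_left hn hF.w_pos.le
  have i2 := mul_le_mul_of_nonneg_left hn' (by linarith : 0 ≤ 1 - w)
  linarith

/-- Doubling the distance to `1` shifts `n` by one, and the factor `1 - w` cancels against the ratio
of consecutive gaps. -/
theorem slopeLE_top (hF : IsBoldValue w ℓ F) {x M : ℝ} (h1 : 1 - ℓ < x)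
    (h : SlopeLE F (2 * x - 1) M) : SlopeLE F x M := by
  have w1 := hF.w_lt
  rw [SlopeLE, ← Filter.map_add_atTop_eq_nat 1, Filter.eventually_map]
  filter_upwards [h, hF.eventually_gap_eq, hF.eventually_increment_top h1] with n hn e e'
  rw [e']
  refine (mul_le_mul_of_nonneg_left hn (by linarith)).trans_eq ?_
  rw [e, mul_left_comm, mul_div_cancel₀ _ (by linarith)]

theorem increment_nonneg (hF : IsBoldValue w ℓ F) {x : ℝ} (h0 : 0 < x) (h1 : x ≤ 1) :
    ∀ᶠ n : ℕ in Filter.atTop, 0 ≤ F x - F (x - (1 / 2) ^ n) := by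
  filter_upwards [eventually_half_pow_le h0] with n hn
  have hp : 0 < (1 / 2 : ℝ) ^ n := by positivity
  exact sub_nonneg.2 (hF.mono ⟨by linarith, by linarith⟩ ⟨h0.le, h1⟩ (by linarith))

theorem hasSlope_bottom (hF : IsBoldValue w ℓ F) {x : ℝ} (hx : x ≤ ℓ) (h : HasSlope F (2 * x)) :
    HasSlope F x := by
  have w0 := hF.w_pos
  have w1 := hF.w_lt
  obtain ⟨c, c0, hc⟩ := h
  refine ⟨w / (1 - w) * c, mul_pos (div_pos w0 (by linarith)) c0, ?_⟩
  rw [← Filter.map_add_atTop_eq_nat 1, Filter.eventually_map]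
  filter_upwards [hc, hF.eventually_gap_eq] with n hn e
  rw [hF.increment_bottom hx]
  refine Eq.trans_le ?_ (mul_le_mul_of_nonneg_left hn w0.le)
  rw [e]
  ring

theorem hasSlope_middle_win (hF : IsBoldValue w ℓ F) {x : ℝ} (h1 : ℓ < x) (h2 : x ≤ 1 - ℓ)
    (h : HasSlope F (x + ℓ)) : HasSlope F x := by
  have w0 := hF.w_pos
  have w1 := hF.w_lt
  have l0 := hF.ℓ_pos
  obtain ⟨c, c0, hc⟩ := h
  refine ⟨w * c, mul_pos w0 c0, ?_⟩
  filter_upwards [hc, hF.eventually_increment_middle h1 h2,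
    hF.increment_nonneg (x := x - ℓ) (by linarith) (by linarith)] with n hn e i
  rw [e]
  have i1 := mul_le_mul_of_nonneg_left hn w0.le
  have i2 := mul_nonneg (by linarith : 0 ≤ 1 - w) i
  linarith

theorem hasSlope_middle_loss (hF : IsBoldValue w ℓ F) {x : ℝ} (h1 : ℓ < x) (h2 : x ≤ 1 - ℓ)
    (h : HasSlope F (x - ℓ)) : HasSlope F x := by
  have w0 := hF.w_pos
  have w1 := hF.w_lt
  have l0 := hF.ℓ_pos
  obtain ⟨c, c0, hc⟩ := h
  refine ⟨(1 - w) * c, mul_pos (by linarith) c0, ?_⟩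
  filter_upwards [hc, hF.eventually_increment_middle h1 h2,
    hF.increment_nonneg (x := x + ℓ) (by linarith) (by linarith)] with n hn e i
  rw [e]
  have i1 := mul_le_mul_of_nonneg_left hn (by linarith : 0 ≤ 1 - w)
  have i2 := mul_nonneg w0.le i
  linarith

/-! ### Vanishing slope where bold play never reaches `1` -/

/-- The fortunes `p + r * ℓ` in `(0, 1]` with rational `p ≤ 0` and `r`. -/
def nonposPart (ℓ : ℝ) : Set ℝ :=
  {x | 0 < x ∧ x ≤ 1 ∧ ∃ p r : ℚ, p ≤ 0 ∧ x = p + r * ℓ}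

theorem ne_one_of_mem_nonposPart (hirr : Irrational ℓ) {x : ℝ} (hx : x ∈ nonposPart ℓ) : x ≠ 1 := by
  rintro rfl
  obtain ⟨-, -, p, r, hp, h⟩ := hx
  rcases eq_or_ne r 0 with rfl | hr
  · have : p = 1 := by
      have : (p : ℝ) = 1 := by simpa using h.symm
      exact_mod_cast this
    linarith
  · refine hirr ⟨(1 - p) / r, ?_⟩
    have : (r : ℝ) ≠ 0 := by exact_mod_cast hr
    push_cast
    rw [div_eq_iff this]
    linarith

/-- The factor is uniform in `x`: from outside the top zone, at most `J` losses lead to the bottom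
zone, whose bet shrinks slopes by `w / (1 - w) = 1 - κ`. The number of top-zone bets before that
depends on `x`, but these cost nothing. -/
theorem slopeLE_contract (hF : IsBoldValue w ℓ F) (hirr : Irrational ℓ) :
    ∃ ρ : ℝ, 0 ≤ ρ ∧ ρ < 1 ∧ ∀ M, 0 ≤ M → (∀ x ∈ nonposPart ℓ, SlopeLE F x M) →
      ∀ x ∈ nonposPart ℓ, SlopeLE F x (ρ * M) := by
  have w0 := hF.w_pos
  have w1 := hF.w_lt
  have l0 := hF.ℓ_pos
  have l1 := hF.ℓ_lt
  obtain ⟨J, hJ⟩ := exists_nat_ge (1 / ℓ)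
  rw [div_le_iff₀ l0] at hJ
  obtain ⟨κ, hκ⟩ : ∃ κ : ℝ, κ = 1 - w / (1 - w) := ⟨_, rfl⟩
  have k0 : 0 < κ := by
    rw [hκ, sub_pos, div_lt_one (by linarith)]
    linarith
  have k1 : κ ≤ 1 := by
    have : 0 ≤ w / (1 - w) := div_nonneg w0.le (by linarith)
    linarith
  have qj : ∀ j : ℕ, 0 < (1 - w) ^ j ∧ (1 - w) ^ j ≤ 1 := fun j =>
    ⟨pow_pos (by linarith) j, pow_le_one₀ (by linarith) (by linarith)⟩
  refine ⟨1 - κ * (1 - w) ^ J, ?_, ?_, ?_⟩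
  · nlinarith [qj J]
  · nlinarith [qj J, mul_pos k0 (qj J).1]
  intro M M0 hM
  have bottom : ∀ j : ℕ, ∀ x ∈ nonposPart ℓ, x ≤ ℓ → SlopeLE F x ((1 - κ * (1 - w) ^ j) * M) := by
    rintro j x ⟨x0, x1, p, r, hp, hx⟩ xl
    have hmem : 2 * x ∈ nonposPart ℓ :=
      ⟨by linarith, by linarith, 2 * p, 2 * r, by linarith, by push_cast; linarith⟩
    refine hF.slopeLE_mono (hF.slopeLE_bottom xl (hM _ hmem)) (mul_le_mul_of_nonneg_right ?_ M0)
    nlinarith [qj j]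
  have level : ∀ j : ℕ, ∀ x ∈ nonposPart ℓ, x ≤ (j + 1) * ℓ → x ≤ 1 - ℓ →
      SlopeLE F x ((1 - κ * (1 - w) ^ j) * M) := by
    intro j
    induction j with
    | zero =>
      intro x hx xl _
      exact bottom 0 x hx (by simpa using xl)
    | succ j ih =>
      intro x hx xj xt
      rcases le_or_gt x ℓ with xl | xl
      · exact bottom (j + 1) x hx xl
      obtain ⟨x0, x1, p, r, hp, e⟩ := hx
      push_cast at xj
      have hup : x + ℓ ∈ nonposPart ℓ :=
        ⟨by linarith, by linarith, p, r + 1, hp, by push_cast; linarith⟩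
      have hdown : x - ℓ ∈ nonposPart ℓ :=
        ⟨by linarith, by linarith, p, r - 1, hp, by push_cast; linarith⟩
      refine hF.slopeLE_mono (hF.slopeLE_middle xl xt (hM _ hup)
        (ih _ hdown (by linarith) (by linarith))) (le_of_eq (by ring))
  -- Each bet in the top zone doubles `1 - x`; as `x ≠ 1`, finitely many of them leave the zone.
  have top : ∀ i : ℕ, ∀ x ∈ nonposPart ℓ, ℓ ≤ 2 ^ i * (1 - x) →
      SlopeLE F x ((1 - κ * (1 - w) ^ J) * M) := by
    intro i
    induction i with
    | zero =>
      intro x hx h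
      rw [pow_zero, one_mul] at h
      exact level J x hx (by linarith) (by linarith)
    | succ i ih =>
      intro x hx h
      rcases le_or_gt x (1 - ℓ) with xt | xt
      · exact level J x hx (by linarith) xt
      obtain ⟨x0, x1, p, r, hp, e⟩ := hx
      refine hF.slopeLE_top xt (ih _ ⟨by linarith, by linarith, 2 * p - 1, 2 * r, by linarith,
        by push_cast; linarith⟩ ?_)
      rw [pow_succ] at h
      linarith
  intro x hx
  have hx1 : 0 < 1 - x := sub_pos.2 (lt_of_le_of_ne hx.2.1 (ne_one_of_mem_nonposPart hirr hx))
  obtain ⟨i, hi⟩ := pow_unbounded_of_one_lt (ℓ / (1 - x)) (one_lt_two (α := ℝ))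
  rw [div_lt_iff₀ hx1] at hi
  exact top i x hx hi.le

theorem slopeLE_of_mem_nonposPart (hF : IsBoldValue w ℓ F) (hH : NoTimidGain w ℓ F)
    (hirr : Irrational ℓ) {η : ℝ} (hη : 0 < η) :
    ∀ x ∈ nonposPart ℓ, SlopeLE F x η := by
  obtain ⟨C, C0, hC⟩ := hF.exists_increment_le hH
  obtain ⟨ρ, r0, r1, hρ⟩ := hF.slopeLE_contract hirr
  have base : ∀ x ∈ nonposPart ℓ, SlopeLE F x C := by
    rintro x ⟨x0, x1, -⟩
    filter_upwards [hC, eventually_half_pow_le x0] with n hn hx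
    have := hn (x - (1 / 2) ^ n) (by linarith) (by linarith)
    rwa [sub_add_cancel] at this
  have iter : ∀ i : ℕ, ∀ x ∈ nonposPart ℓ, SlopeLE F x (ρ ^ i * C) := by
    intro i
    induction i with
    | zero => simpa using base
    | succ i ih =>
      rw [pow_succ', mul_assoc]
      exact hρ _ (by positivity) ih
  obtain ⟨i, hi⟩ := exists_pow_lt_of_lt_one (div_pos hη C0) r1
  rw [lt_div_iff₀ C0] at hi
  exact fun x hx => hF.slopeLE_mono (iter i x hx) hi.le

/-! ### The profitable deviation -/

theorem not_noTimidGain (hF : IsBoldValue w ℓ F) (hirr : Irrational ℓ) : ¬ NoTimidGain w ℓ F := by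
  intro hH
  have w0 := hF.w_pos
  have w1 := hF.w_lt
  have l0 := hF.ℓ_pos
  have l1 := hF.ℓ_lt
  -- `N + 2` is the integer part of `1 / ℓ`; irrationality makes the first inequality strict.
  obtain ⟨N, hN1, hN2⟩ : ∃ N : ℕ, (N + 2) * ℓ < 1 ∧ 1 < (N + 3) * ℓ := by
    have hfl := Nat.floor_le (one_div_pos.2 l0).le
    have hlt := Nat.lt_floor_add_one (1 / ℓ)
    have h2 : 2 ≤ ⌊1 / ℓ⌋₊ := by
      refine Nat.le_floor ?_
      rw [le_div_iff₀ l0]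
      push_cast
      linarith
    obtain ⟨N, hN⟩ := Nat.exists_eq_add_of_le' h2
    rw [hN] at hfl hlt
    push_cast at hfl hlt
    rw [le_div_iff₀ l0] at hfl
    rw [div_lt_iff₀ l0] at hlt
    refine ⟨N, lt_of_le_of_ne hfl fun h => ?_, by linarith⟩
    refine hirr ⟨1 / (N + 2), ?_⟩
    push_cast
    rw [div_eq_iff (by positivity), ← h]
    ring
  -- Positive slope spreads from `1`: down to `c` by wins of `ℓ`, then to `c / 2 ^ k` by bottom
  -- doublings, and then up to `t + N * ℓ` by losses of `ℓ`.
  have hc1 : ∀ j : ℕ, j ≤ N + 1 → HasSlope F (1 - j * ℓ) := by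
    intro j
    induction j with
    | zero => simpa using hasSlope_one F
    | succ j ih =>
      intro hj
      have hjN : (j : ℝ) + 1 ≤ N + 1 := by exact_mod_cast hj
      have := mul_le_mul_of_nonneg_right hjN l0.le
      have hj0 : 0 ≤ (j : ℝ) * ℓ := by positivity
      push_cast
      refine hF.hasSlope_middle_win (by linarith) (by linarith) ?_
      rw [show 1 - ((j : ℝ) + 1) * ℓ + ℓ = 1 - j * ℓ by ring]
      exact ih (by omega)
  obtain ⟨c, hc⟩ : ∃ c : ℝ, c = 1 - ((N + 1 : ℕ) : ℝ) * ℓ := ⟨_, rfl⟩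
  have hcs : HasSlope F c := hc ▸ hc1 (N + 1) le_rfl
  push_cast at hc
  have c0 : ℓ < c := by linarith
  have c2 : c < 2 * ℓ := by linarith
  have hck : ∀ k : ℕ, HasSlope F (c * (1 / 2) ^ k) := by
    intro k
    induction k with
    | zero => simpa using hcs
    | succ k ih =>
      have hk : (1 / 2 : ℝ) ^ k ≤ 1 := pow_le_one₀ (by norm_num) (by norm_num)
      refine hF.hasSlope_bottom ?_ ?_
      · rw [pow_succ]
        nlinarith
      · rwa [show 2 * (c * (1 / 2 : ℝ) ^ (k + 1)) = c * (1 / 2) ^ k by ring]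
  -- `k` is so large that `f + ℓ = t + (N + 2) * ℓ` stays below `1`.
  obtain ⟨k, hk⟩ := exists_pow_lt_of_lt_one
    (div_pos (sub_pos.2 hN1) (l0.trans c0)) (by norm_num : (1 / 2 : ℝ) < 1)
  rw [lt_div_iff₀ (l0.trans c0), mul_comm] at hk
  have hk1 : k ≠ 0 := by
    rintro rfl
    rw [pow_zero, mul_one] at hk
    linarith
  obtain ⟨t, ht⟩ : ∃ t : ℝ, t = c * (1 / 2) ^ k := ⟨_, rfl⟩
  have t0 : 0 < t := by
    rw [ht]
    have := l0.trans c0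
    positivity
  rw [← ht] at hk
  have htj : ∀ j : ℕ, j ≤ N → HasSlope F (t + j * ℓ) := by
    intro j
    induction j with
    | zero =>
      intro _
      have := hck k
      rw [← ht] at this
      simpa using this
    | succ j ih =>
      intro hj
      have hjN : (j : ℝ) + 1 ≤ N := by exact_mod_cast hj
      have := mul_le_mul_of_nonneg_right hjN l0.le
      have hj0 : 0 ≤ (j : ℝ) * ℓ := by positivity
      push_cast
      refine hF.hasSlope_middle_loss (by linarith) (by linarith) ?_
      rw [show t + ((j : ℝ) + 1) * ℓ - ℓ = t + j * ℓ by ring]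
      exact ih (by omega)
  obtain ⟨f, hf⟩ : ∃ f : ℝ, f = t + (N + 1) * ℓ := ⟨_, rfl⟩
  have hN0 : 0 ≤ (N : ℝ) * ℓ := by positivity
  obtain ⟨b, b0, hb⟩ := htj N le_rfl
  have hfℓ : t + N * ℓ = f - ℓ := by rw [hf]; ring
  rw [hfℓ] at hb
  -- The rational part is `2 / 2 ^ k - 1`, nonpositive because `k ≥ 1`.
  have hmem : 2 * (f + ℓ) - 1 ∈ nonposPart ℓ := by
    refine ⟨by linarith, by linarith, 2 * (1 / 2) ^ k - 1,
      2 * (-(N + 1) * (1 / 2) ^ k + N + 2), ?_, ?_⟩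
    · obtain ⟨k, rfl⟩ := Nat.exists_eq_succ_of_ne_zero hk1
      have : (1 / 2 : ℚ) ^ k ≤ 1 := pow_le_one₀ (by norm_num) (by norm_num)
      rw [Nat.succ_eq_add_one, pow_succ]
      linarith
    · push_cast
      rw [hf, ht, hc]
      ring
  have hup : SlopeLE F (f + ℓ) (b / 2) :=
    hF.slopeLE_top (by linarith) (hF.slopeLE_of_mem_nonposPart hH hirr (by positivity) _ hmem)
  rw [SlopeLE] at hup
  have hb' := hb
  rw [← Filter.map_add_atTop_eq_nat 1, Filter.eventually_map] at hb'
  obtain ⟨n, hn, hlow, e, hsmall⟩ := (hup.and (hb'.and (hF.eventually_gap_eq.and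
    (eventually_half_pow_le (a := min t ℓ) (lt_min t0 l0))))).exists
  have hst := hsmall.trans (min_le_left _ _)
  have hsl := hsmall.trans (min_le_right _ _)
  have hε : 0 < (1 / 2 : ℝ) ^ (n + 1) := by positivity
  obtain ⟨ε, he⟩ : ∃ ε : ℝ, ε = (1 / 2) ^ (n + 1) := ⟨_, rfl⟩
  have h2ε : (1 / 2 : ℝ) ^ n = 2 * ε := by rw [he]; ring
  rw [← he] at hlow hε
  rw [h2ε] at hn hst hsl
  -- The smaller stake leads to `f + ℓ - 2 * ε` or `f - ℓ`, the bold one to `f + ℓ - ε` or `f - ℓ -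
  -- ε`.
  have hgain := hH (f - ε) ⟨by linarith, by linarith⟩ (ℓ - ε) ⟨by linarith,
    lt_min (by linarith) (lt_min (by linarith) (by linarith))⟩
  have hmid := hF.eq_middle (x := f - ε) (by linarith) (by linarith)
  rw [show f - ε + (ℓ - ε) = f + ℓ - 2 * ε by ring, show f - ε - (ℓ - ε) = f - ℓ by ring, hmid,
    show f - ε + ℓ = f + ℓ - ε by ring, show f - ε - ℓ = f - ℓ - ε by ring] at hgain
  have hmono := hF.mono (a := f + ℓ - ε) (b := f + ℓ) ⟨by linarith, by linarith⟩
    ⟨by linarith, by linarith⟩ (by linarith)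
  have i1 := mul_le_mul_of_nonneg_left (sub_le_sub_right hmono (F (f + ℓ - 2 * ε))) w0.le
  have i2 := mul_le_mul_of_nonneg_left hn w0.le
  have i3 := mul_le_mul_of_nonneg_left hlow (by linarith : 0 ≤ 1 - w)
  have g1 := hF.gap_pos (n + 1)
  have g0 := hF.gap_pos n
  have e' : gap F (n + 1) = (1 - w) * gap F n := by
    rw [e, mul_div_cancel₀ _ (by linarith)]
  rw [e'] at i3
  -- In units of `b * gap F n`, the gain is at least `(1 - w) ^ 2 > 1 / 4` and the loss at most `w /
  -- 2 < 1 / 4`.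
  have hbg := mul_pos (mul_pos b0 g0) (by nlinarith : 0 < (1 - w) ^ 2 - w / 2)
  linarith

end IsBoldValue

theorem isBoldValue_Q {w : unitInterval} (hw0 : 0 < (w : ℝ)) (hw : (w : ℝ) < 1 / 2) {ℓ : ℝ}
    (hℓ0 : 0 < ℓ) (hℓ : ℓ < 1 / 2) : IsBoldValue w ℓ (Q w ℓ) where
  w_pos := hw0
  w_lt := hw
  ℓ_pos := hℓ0
  ℓ_lt := hℓ
  map_zero := Q_zero hℓ0.le
  map_one := Q_one
  mono := Q_monotoneOn hℓ0.le
  le_self _ hx := Q_le_self hℓ0.le hw.le hx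
  eq := Q_eq hℓ0.le

end RedAndBlack

theorem theorem1 (w : unitInterval) (hw0 : 0 < (w : ℝ)) (hw : (w : ℝ) < 1 / 2)
    (ℓ : ℝ) (hℓ0 : 0 < ℓ) (hℓ : ℓ < 1 / 2) (hirr : Irrational ℓ) :
    ¬ RedAndBlack.IsOptimal w ℓ (RedAndBlack.bold ℓ) ∧
      ∃ f ∈ Set.Ioo (0 : ℝ) 1, ∃ ε ∈ Set.Ioo (0 : ℝ) (RedAndBlack.boldStake ℓ f),
        (w : ℝ) * RedAndBlack.Q w ℓ (f + RedAndBlack.boldStake ℓ f - ε)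
            + (1 - (w : ℝ)) * RedAndBlack.Q w ℓ (f - RedAndBlack.boldStake ℓ f + ε)
          > RedAndBlack.Q w ℓ f := by
  have hnot := (RedAndBlack.isBoldValue_Q hw0 hw hℓ0 hℓ).not_noTimidGain hirr
  simp only [RedAndBlack.NoTimidGain, not_forall, not_le] at hnot
  obtain ⟨f, hf, s, hs, h⟩ := hnot
  have hε : RedAndBlack.boldStake ℓ f - s ∈ Set.Ioo (0 : ℝ) (RedAndBlack.boldStake ℓ f) :=
    ⟨sub_pos.2 hs.2, sub_lt_self _ hs.1⟩
  have e1 : f + s = f + RedAndBlack.boldStake ℓ f - (RedAndBlack.boldStake ℓ f - s) := by ring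
  have e2 : f - s = f - RedAndBlack.boldStake ℓ f + (RedAndBlack.boldStake ℓ f - s) := by ring
  rw [e1, e2] at h
  exact ⟨RedAndBlack.not_isOptimal_bold hℓ0.le hf hε h, f, hf, _, hε, h⟩
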